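/- Theorem 1.3. Let $\mathbb D$ be the open unit disk and $\mathbb T$ the unit circle. Let $\{\lambda_n\}$ be a finite (possibly empty) or countable family of points of $\mathbb D$, listed with multiplicity, with $\sum_n(1-|\lambda_n|)<\infty$, let $\mu$ be a finite positive Borel measure on $\mathbb T$ that is singular with respect to arc length, and let $I=c\,B\,S_\mu$ be the inner function with $$B(z)=\prod_n b_{\lambda_n}(z),\qquad b_\lambda(z)=\frac{|\lambda|}{\lambda}\,\frac{\lambda-z}{1-\overline{\lambda}z}\ (\lambda\ne0),\quad b_0(z)=z,\qquad S_\mu(z)=\exp\Big(-\int_{\mathbb T}\frac{\xi+z}{\xi-z}\,d\mu(\xi)\Big),$$ and $|c|=1$. Call $\varphi:(0,\infty)\to(0,\infty)$ admissible if it is (weakly) increasing, $\varphi(x)/x$ is bounded near $0$, $\varphi(x)/x^2$ is (weakly) decreasing on $(0,\infty)$, and $\varphi(x)\asymp\varphi(x+g(x))$ as $x\downarrow0$ whenever $g(x)=o(x)$. Let $\varphi$ be admissible and $\zeta\in\mathbb T$, and assume, with the convention $1/\varphi(0)=+\infty$, that $$\sum_n\frac{1-|\lambda_n|}{\varphi(|\zeta-\lambda_n|)}+\int_{\mathbb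 T}\frac{d\mu(\xi)}{\varphi(|\zeta-\xi|)}<\infty .$$ Let $H^2$ be the Hardy space of holomorphic $f$ on $\mathbb D$ with $\|f\|^2=\sup_{0\le r<1}\frac1{2\pi}\int_0^{2\pi}|f(re^{it})|^2\,dt<\infty$ and with inner product $\langle f,g\rangle=\lim_{r\to1^-}\frac1{2\pi}\int_0^{2\pi}f(re^{it})\overline{g(re^{it})}\,dt$, and let $(IH^2)^\perp$ be the orthogonal complement of $IH^2$ in $H^2$. Then there is a constant $C>0$, depending only on $I$, $\varphi$ and $\zeta$, such that every $f\in(IH^2)^\perp$ satisfies $$|f(r\zeta)|\le C\,\|f\|\,\frac{\sqrt{\varphi(1-r)}}{1-r}\qquad\text{for all } 0\le r<1 .$$ -/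

import Mathlib

open Set Filter Topology MeasureTheory Asymptotics
open scoped ENNReal ComplexConjugate

noncomputable section

/-- Admissible functions `φ : (0, ∞) → (0, ∞)`; only the values on `(0, ∞)` are used.
Boundedness of `φ x / x` is asked for near `0` only, so that `x ^ p` with `1 ≤ p < 2` is
admissible. -/
structure IsAdmissible (φ : ℝ → ℝ) : Prop where
  pos : ∀ x, 0 < x → 0 < φ x
  mono : MonotoneOn φ (Ioi 0)
  bounded : ∃ C δ : ℝ, 0 < δ ∧ ∀ x ∈ Ioo 0 δ, φ x / x ≤ C
  anti : AntitoneOn (fun x => φ x / x ^ 2) (Ioi 0)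
  /-- `φ x ≍ φ (x + o(x))` as `x ↓ 0`. -/
  theta : ∀ g : ℝ → ℝ, g =o[𝓝[>] 0] (fun x => x) → φ =Θ[𝓝[>] 0] (fun x => φ (x + g x))

/-- `1 / φ d` for `d > 0`, with the convention `1 / φ 0 = ∞` (an admissible `φ` tends to `0`
at `0`). -/
def invWeight (φ : ℝ → ℝ) (d : ℝ) : ℝ≥0∞ :=
  if 0 < d then (ENNReal.ofReal (φ d))⁻¹ else ∞

/-- The Blaschke factor with zero `a` in the unit disk; it is `z` when `a = 0`. -/
def blaschkeFactor (a z : ℂ) : ℂ :=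
  if a = 0 then z else ((‖a‖ : ℂ) / a) * ((a - z) / (1 - conj a * z))

/-- The Blaschke product with zeros `Λ i`, repeated according to multiplicity. -/
def blaschkeProduct {ι : Type*} (Λ : ι → ℂ) (z : ℂ) : ℂ :=
  ∏' i, blaschkeFactor (Λ i) z

/-- The unit circle `𝕋`, as a subspace of `ℂ`. -/
abbrev UnitCircle : Type := Metric.sphere (0 : ℂ) 1

/-- Arc length on the unit circle. -/
def arcLength : Measure UnitCircle := (volume : Measure ℂ).toSphere

/-- The singular inner function `S_μ`. -/
def singularInner (μ : Measure UnitCircle) (z : ℂ) : ℂ :=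
  Complex.exp (-∫ ξ : UnitCircle, ((ξ : ℂ) + z) / ((ξ : ℂ) - z) ∂μ)

/-- `‖f‖² = sup_{0 ≤ r < 1} (1/2π) ∫ |f(r e^{it})|² dt`: the set of these integral means. -/
def squareMeans (f : ℂ → ℂ) : Set ℝ :=
  (fun r : ℝ => Real.circleAverage (fun w => ‖f w‖ ^ 2) 0 r) '' Ico 0 1

/-- `f` belongs to the Hardy space `H²` of the unit disk; only the values of `f` on the open
disk matter. -/
def MemHardy (f : ℂ → ℂ) : Prop :=
  DifferentiableOn ℂ f (Metric.ball 0 1) ∧ BddAbove (squareMeans f)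

/-- The norm of `H²`. -/
def hardyNorm (f : ℂ → ℂ) : ℝ := √(sSup (squareMeans f))

/-- `⟨f, g⟩ = c` in `H²`, that is
`lim_{r → 1⁻} (1/2π) ∫ f(r e^{it}) * conj (g(r e^{it})) dt = c`. -/
def HasHardyInner (f g : ℂ → ℂ) (c : ℂ) : Prop :=
  Tendsto (fun r : ℝ => Real.circleAverage (fun w => f w * conj (g w)) 0 r) (𝓝[<] 1) (𝓝 c)

/-- `f` belongs to the model space `(I H²)^⊥`, the orthogonal complement of `I H²` in `H²`. -/
def MemModelSpace (I f : ℂ → ℂ) : Prop :=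
  MemHardy f ∧ ∀ g, MemHardy g → HasHardyInner f (fun z => I z * g z) 0

end

/-! ### Blaschke products -/

/-! Evaluation at `a` on the model space is pairing with the kernel (1 - conj (I a) I(w)) / (1 -
conj a w), so |f(a)|² ≤ ‖f‖² (1 - |I(a)|²) / (1 - |a|²) (`MemModelSpace.norm_le`). It remains to
show 1 - |I(rζ)|² ≲ (1 - r²) φ(1-r) / (1-r)².

The defect 1 - |I|² is subadditive over factors: 1 - ∏ xᵢ ≤ ∑ (1 - xᵢ) on [0, 1] handles the zeros
and 1 - e^{-x} ≤ x handles the singular factor. With z = rζ, this leaves (1 - r²) times the sum of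
(1 - |λ|) / |1 - conj λ z|² and the integral of 1 / |ξ - z|² dμ, up to constants. Each denominator
D² satisfies 1 / D² ≤ 4 φ(1-r) / ((1-r)² φ(d)), with d the distance from ζ to λ or ξ
(`IsAdmissible.mul_sq_le`). Summing and integrating recovers the assumed finite quantity. -/

lemma one_sub_conj_mul_ne_zero {a z : ℂ} (ha : ‖a‖ < 1) (hz : ‖z‖ < 1) : 1 - conj a * z ≠ 0 := by
  intro h
  have h1 : ‖conj a * z‖ = 1 := by rw [← sub_eq_zero.mp h, norm_one]
  rw [norm_mul, RCLike.norm_conj] at h1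
  nlinarith [norm_nonneg a, norm_nonneg z]

lemma one_sub_norm_blaschkeFactor_sq {a z : ℂ} (ha : ‖a‖ < 1) (hz : ‖z‖ < 1) :
    1 - ‖blaschkeFactor a z‖ ^ 2 = (1 - ‖a‖ ^ 2) * (1 - ‖z‖ ^ 2) / ‖1 - conj a * z‖ ^ 2 := by
  unfold blaschkeFactor
  split_ifs with h
  · simp [h]
  · have h0 : ‖1 - conj a * z‖ ≠ 0 := norm_ne_zero_iff.mpr (one_sub_conj_mul_ne_zero ha hz)
    have ha0 : ‖a‖ ≠ 0 := norm_ne_zero_iff.mpr h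
    rw [norm_mul, norm_div, norm_div, Complex.norm_real, norm_norm, div_self ha0, one_mul, div_pow,
      eq_div_iff (pow_ne_zero 2 h0), sub_mul, div_mul_cancel₀ _ (pow_ne_zero 2 h0), one_mul]
    simp only [Complex.sq_norm, Complex.normSq_apply, Complex.sub_re, Complex.sub_im,
      Complex.mul_re, Complex.mul_im, Complex.conj_re, Complex.conj_im, Complex.one_re,
      Complex.one_im]
    ring

lemma norm_blaschkeFactor_le_one {a z : ℂ} (ha : ‖a‖ < 1) (hz : ‖z‖ < 1) :
    ‖blaschkeFactor a z‖ ≤ 1 := by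
  have h := one_sub_norm_blaschkeFactor_sq ha hz
  have h1 : 0 ≤ (1 - ‖a‖ ^ 2) * (1 - ‖z‖ ^ 2) / ‖1 - conj a * z‖ ^ 2 := by
    have : 0 ≤ 1 - ‖a‖ ^ 2 := by nlinarith [norm_nonneg a]
    have : 0 ≤ 1 - ‖z‖ ^ 2 := by nlinarith [norm_nonneg z]
    positivity
  exact (sq_le_one_iff₀ (norm_nonneg _)).mp (by linarith)

lemma one_sub_norm_le_norm_one_sub {a z : ℂ} (ha : ‖a‖ ≤ 1) :
    1 - ‖z‖ ≤ ‖1 - conj a * z‖ := by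
  have h := norm_sub_norm_le 1 (conj a * z)
  rw [norm_one, norm_mul, RCLike.norm_conj] at h
  nlinarith [norm_nonneg z, norm_nonneg a]

/-- The normalisation |a|/a lets 1 - |a| factor out of the difference, so the Blaschke condition
gives locally uniform convergence of the product. -/
lemma norm_blaschkeFactor_sub_one_le {a z : ℂ} {R : ℝ} (hR : R < 1) (ha : ‖a‖ < 1)
    (hz : ‖z‖ ≤ R) : ‖blaschkeFactor a z - 1‖ ≤ 2 / (1 - R) * (1 - ‖a‖) := by
  have hz0 := norm_nonneg z
  have hz1 : ‖z‖ < 1 := hz.trans_lt hR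
  have hR' : 0 < 1 - R := by linarith
  unfold blaschkeFactor
  split_ifs with h
  · rw [h, norm_zero, sub_zero, mul_one, le_div_iff₀ hR']
    have := norm_sub_le z 1
    rw [norm_one] at this
    nlinarith [norm_nonneg (z - 1)]
  · have h0 := one_sub_conj_mul_ne_zero ha hz1
    have hsq : conj a * a = (‖a‖ : ℂ) ^ 2 := by
      rw [mul_comm, Complex.mul_conj, Complex.normSq_eq_norm_sq]; push_cast; ring
    have key : ((‖a‖ : ℂ) / a) * ((a - z) / (1 - conj a * z)) - 1
        = -((1 - ‖a‖ : ℝ) : ℂ) * ((a + ‖a‖ * z) / a) / (1 - conj a * z) := by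
      have hD : a * (1 - conj a * z) = a - ‖a‖ ^ 2 * z := by linear_combination -z * hsq
      generalize 1 - conj a * z = D at h0 hD ⊢
      field_simp
      push_cast
      linear_combination -hD
    have hb : ‖(a + ‖a‖ * z) / a‖ ≤ 2 := by
      have ha0 : 0 < ‖a‖ := norm_pos_iff.mpr h
      rw [norm_div, div_le_iff₀ ha0]
      have := norm_add_le a (‖a‖ * z)
      rw [norm_mul, Complex.norm_real, norm_norm] at this
      nlinarith
    have hd := one_sub_norm_le_norm_one_sub (z := z) ha.le
    rw [key, norm_div, norm_mul, norm_neg, Complex.norm_real, Real.norm_of_nonneg (by linarith)]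
    calc (1 - ‖a‖) * ‖(a + ‖a‖ * z) / a‖ / ‖1 - conj a * z‖
        ≤ (1 - ‖a‖) * 2 / (1 - R) := by
          gcongr
          linarith
      _ = 2 / (1 - R) * (1 - ‖a‖) := by ring

lemma differentiableOn_blaschkeFactor {a : ℂ} (ha : ‖a‖ < 1) :
    DifferentiableOn ℂ (blaschkeFactor a) (Metric.ball 0 1) := by
  intro z hz
  have h0 := one_sub_conj_mul_ne_zero ha (mem_ball_zero_iff.mp hz)
  refine DifferentiableAt.differentiableWithinAt ?_
  unfold blaschkeFactor
  split_ifs with h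
  · fun_prop
  · fun_prop (disch := exact h0)

section Blaschke

variable {ι : Type*} {Λ : ι → ℂ}

lemma hasProdLocallyUniformlyOn_blaschkeFactor (hΛ : ∀ i, ‖Λ i‖ < 1)
    (hsum : Summable fun i => 1 - ‖Λ i‖) {R : ℝ} (hR : R < 1) :
    HasProdLocallyUniformlyOn (fun i => blaschkeFactor (Λ i)) (blaschkeProduct Λ)
      (Metric.ball 0 R) := by
  have h := Summable.hasProdLocallyUniformlyOn_one_add
    (f := fun i z => blaschkeFactor (Λ i) z - 1) (K := Metric.ball (0 : ℂ) R)
    Metric.isOpen_ball (hsum.mul_left (2 / (1 - R)))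
    (Eventually.of_forall fun i z hz =>
      norm_blaschkeFactor_sub_one_le hR (hΛ i) (mem_ball_zero_iff.mp hz).le)
    (fun i => ((differentiableOn_blaschkeFactor (hΛ i)).continuousOn.mono
      (Metric.ball_subset_ball hR.le)).sub continuousOn_const)
  simp only [add_sub_cancel] at h
  exact h

lemma hasProd_blaschkeFactor (hΛ : ∀ i, ‖Λ i‖ < 1) (hsum : Summable fun i => 1 - ‖Λ i‖) {z : ℂ}
    (hz : ‖z‖ < 1) : HasProd (fun i => blaschkeFactor (Λ i) z) (blaschkeProduct Λ z) := by
  obtain ⟨R, hzR, hR⟩ := exists_between hz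
  exact (hasProdLocallyUniformlyOn_blaschkeFactor hΛ hsum hR).hasProd (mem_ball_zero_iff.mpr hzR)

lemma differentiableOn_blaschkeProduct (hΛ : ∀ i, ‖Λ i‖ < 1)
    (hsum : Summable fun i => 1 - ‖Λ i‖) :
    DifferentiableOn ℂ (blaschkeProduct Λ) (Metric.ball 0 1) := by
  intro z hz
  obtain ⟨R, hzR, hR⟩ := exists_between (mem_ball_zero_iff.mp hz)
  have h := (hasProdLocallyUniformlyOn_blaschkeFactor hΛ hsum hR)
  rw [hasProdLocallyUniformlyOn_iff_tendstoLocallyUniformlyOn] at h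
  have hd : DifferentiableOn ℂ (blaschkeProduct Λ) (Metric.ball 0 R) :=
    h.differentiableOn (Eventually.of_forall fun s => DifferentiableOn.fun_finsetProd fun i _ =>
      (differentiableOn_blaschkeFactor (hΛ i)).mono (Metric.ball_subset_ball hR.le))
      Metric.isOpen_ball
  exact (hd.differentiableAt (Metric.isOpen_ball.mem_nhds
    (mem_ball_zero_iff.mpr hzR))).differentiableWithinAt

/-- Induction from 1 - xP = (1 - x) + x(1 - P) ≤ (1 - x) + (1 - P). -/
lemma one_sub_prod_le_sum_one_sub {s : Finset ι} {x : ι → ℝ} (h0 : ∀ i, 0 ≤ x i)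
    (h1 : ∀ i, x i ≤ 1) : 1 - ∏ i ∈ s, x i ≤ ∑ i ∈ s, (1 - x i) := by
  classical
  induction s using Finset.induction_on with
  | empty => simp
  | insert i s hi ih =>
    rw [Finset.prod_insert hi, Finset.sum_insert hi]
    have hp : ∏ j ∈ s, x j ≤ 1 := Finset.prod_le_one (fun j _ => h0 j) fun j _ => h1 j
    nlinarith [h0 i, h1 i]

lemma norm_blaschkeProduct_le_one (hΛ : ∀ i, ‖Λ i‖ < 1) (hsum : Summable fun i => 1 - ‖Λ i‖)
    {z : ℂ} (hz : ‖z‖ < 1) : ‖blaschkeProduct Λ z‖ ≤ 1 :=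
  le_of_tendsto' (hasProd_blaschkeFactor hΛ hsum hz).norm fun _ =>
    Finset.prod_le_one (fun _ _ => norm_nonneg _) fun i _ => norm_blaschkeFactor_le_one (hΛ i) hz

lemma one_sub_norm_blaschkeProduct_sq_le (hΛ : ∀ i, ‖Λ i‖ < 1)
    (hsum : Summable fun i => 1 - ‖Λ i‖) {z : ℂ} (hz : ‖z‖ < 1) {T : ℝ}
    (hT : ∀ s : Finset ι, ∑ i ∈ s, (1 - ‖blaschkeFactor (Λ i) z‖ ^ 2) ≤ T) :
    1 - ‖blaschkeProduct Λ z‖ ^ 2 ≤ T := by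
  have h : Tendsto (fun s : Finset ι => 1 - (∏ i ∈ s, ‖blaschkeFactor (Λ i) z‖) ^ 2) atTop
      (𝓝 (1 - ‖blaschkeProduct Λ z‖ ^ 2)) :=
    (Tendsto.pow (hasProd_blaschkeFactor hΛ hsum hz).norm 2).const_sub 1
  refine le_of_tendsto' h fun s => le_trans ?_ (hT s)
  rw [← Finset.prod_pow]
  exact one_sub_prod_le_sum_one_sub (fun i => sq_nonneg _)
    fun i => pow_le_one₀ (norm_nonneg _) (norm_blaschkeFactor_le_one (hΛ i) hz)

end Blaschke

/-! ### Singular inner functions -/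

lemma one_sub_norm_le_norm_sub (ξ : UnitCircle) (z : ℂ) : 1 - ‖z‖ ≤ ‖(ξ : ℂ) - z‖ := by
  have h := norm_sub_norm_le (ξ : ℂ) z
  rwa [mem_sphere_zero_iff_norm.mp ξ.2] at h

lemma circle_sub_ne_zero (ξ : UnitCircle) {z : ℂ} (hz : ‖z‖ < 1) : (ξ : ℂ) - z ≠ 0 :=
  norm_pos_iff.mp (lt_of_lt_of_le (by linarith) (one_sub_norm_le_norm_sub ξ z))

lemma continuous_herglotz {z : ℂ} (hz : ‖z‖ < 1) :
    Continuous fun ξ : UnitCircle => ((ξ : ℂ) + z) / ((ξ : ℂ) - z) :=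
  (by fun_prop : Continuous fun ξ : UnitCircle => (ξ : ℂ) + z).div (by fun_prop)
    fun ξ => circle_sub_ne_zero ξ hz

/-- This is the Poisson kernel; it makes |S_μ| explicit. -/
lemma re_herglotz (ξ : UnitCircle) {z : ℂ} (hz : ‖z‖ < 1) :
    (((ξ : ℂ) + z) / ((ξ : ℂ) - z)).re = (1 - ‖z‖ ^ 2) * (1 / ‖(ξ : ℂ) - z‖ ^ 2) := by
  have h : ‖(ξ : ℂ) - z‖ ^ 2 ≠ 0 :=
    pow_ne_zero 2 (norm_ne_zero_iff.mpr (circle_sub_ne_zero ξ hz))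
  have h1 : ‖(ξ : ℂ)‖ ^ 2 = 1 := by rw [mem_sphere_zero_iff_norm.mp ξ.2, one_pow]
  rw [Complex.div_re, ← add_div, ← Complex.sq_norm, mul_one_div]
  congr 1
  simp only [Complex.sq_norm, Complex.normSq_apply, Complex.sub_re, Complex.sub_im,
    Complex.add_re, Complex.add_im] at h1 ⊢
  linear_combination h1

section Singular

variable (μ : Measure UnitCircle) [IsFiniteMeasure μ]

lemma integrable_of_continuous_unitCircle {E : Type*} [NormedAddCommGroup E] {f : UnitCircle → E}
    (hf : Continuous f) : Integrable f μ :=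
  hf.integrable_of_hasCompactSupport (HasCompactSupport.of_compactSpace f)

lemma differentiableOn_singularInner :
    DifferentiableOn ℂ (singularInner μ) (Metric.ball 0 1) := by
  intro z hz
  obtain ⟨R, hzR, hR⟩ := exists_between (mem_ball_zero_iff.mp hz)
  have h : HasDerivAt (fun w => ∫ ξ : UnitCircle, ((ξ : ℂ) + w) / ((ξ : ℂ) - w) ∂μ)
      (∫ ξ : UnitCircle, 2 * (ξ : ℂ) / ((ξ : ℂ) - z) ^ 2 ∂μ) z := by
    -- The dominating constant comes from |ξ| = 1 and |ξ - w| ≥ 1 - R on the ball of radius R.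
    refine (hasDerivAt_integral_of_dominated_loc_of_deriv_le (μ := μ) (s := Metric.ball 0 R)
      (F := fun w (ξ : UnitCircle) => ((ξ : ℂ) + w) / ((ξ : ℂ) - w))
      (F' := fun w (ξ : UnitCircle) => 2 * (ξ : ℂ) / ((ξ : ℂ) - w) ^ 2) (bound := fun _ => 2 / (1 - R) ^ 2)
      (Metric.isOpen_ball.mem_nhds (mem_ball_zero_iff.mpr hzR)) ?_ ?_ ?_ ?_
      (integrable_const _) ?_).2
    · filter_upwards [Metric.isOpen_ball.mem_nhds hz] with w hw
      exact (continuous_herglotz (mem_ball_zero_iff.mp hw)).aestronglyMeasurable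
    · exact integrable_of_continuous_unitCircle μ (continuous_herglotz (mem_ball_zero_iff.mp hz))
    · exact ((by fun_prop : Continuous fun ξ : UnitCircle => 2 * (ξ : ℂ)).div (by fun_prop)
        fun ξ => pow_ne_zero 2
          (circle_sub_ne_zero ξ (mem_ball_zero_iff.mp hz))).aestronglyMeasurable
    · refine Eventually.of_forall fun ξ w hw => ?_
      have hw' := mem_ball_zero_iff.mp hw
      have := one_sub_norm_le_norm_sub ξ w
      rw [norm_div, norm_mul, mem_sphere_zero_iff_norm.mp ξ.2, norm_pow, mul_one,
        Complex.norm_ofNat]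
      have : 0 < 1 - R := by linarith
      gcongr
      linarith
    · refine Eventually.of_forall fun ξ w hw => ?_
      have h0 := circle_sub_ne_zero ξ ((mem_ball_zero_iff.mp hw).trans hR)
      refine (((hasDerivAt_id w).const_add (ξ : ℂ)).div ((hasDerivAt_id w).const_sub (ξ : ℂ))
        h0).congr_deriv ?_
      simp only [id]
      ring
  exact h.neg.cexp.differentiableAt.differentiableWithinAt

lemma norm_singularInner {z : ℂ} (hz : ‖z‖ < 1) :
    ‖singularInner μ z‖
      = Real.exp (-((1 - ‖z‖ ^ 2) * ∫ ξ : UnitCircle, 1 / ‖(ξ : ℂ) - z‖ ^ 2 ∂μ)) := by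
  unfold singularInner
  rw [Complex.norm_exp, Complex.neg_re, ← integral_const_mul]
  simp_rw [← re_herglotz _ hz]
  congr 2
  exact (integral_re (integrable_of_continuous_unitCircle μ (continuous_herglotz hz))).symm

lemma norm_singularInner_le_one {z : ℂ} (hz : ‖z‖ < 1) : ‖singularInner μ z‖ ≤ 1 := by
  rw [norm_singularInner μ hz, Real.exp_le_one_iff, neg_nonpos]
  exact mul_nonneg (by nlinarith [norm_nonneg z]) (integral_nonneg fun _ => by positivity)

lemma one_sub_norm_singularInner_sq_le {z : ℂ} (hz : ‖z‖ < 1) :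
    1 - ‖singularInner μ z‖ ^ 2
      ≤ 2 * ((1 - ‖z‖ ^ 2) * ∫ ξ : UnitCircle, 1 / ‖(ξ : ℂ) - z‖ ^ 2 ∂μ) := by
  rw [norm_singularInner μ hz, ← Real.exp_nat_mul]
  have := Real.add_one_le_exp (((2 : ℕ) : ℝ) *
    -((1 - ‖z‖ ^ 2) * ∫ ξ : UnitCircle, 1 / ‖(ξ : ℂ) - z‖ ^ 2 ∂μ))
  push_cast at this ⊢
  linarith

end Singular

/-! ### Hardy space and model space -/

section Hardy

variable {f : ℂ → ℂ} {ρ : ℝ}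

lemma norm_lt_one_of_mem_sphere (hρ : ρ ∈ Ioo (0 : ℝ) 1) {w : ℂ}
    (hw : w ∈ Metric.sphere (0 : ℂ) |ρ|) : ‖w‖ < 1 := by
  rw [mem_sphere_zero_iff_norm.mp hw, abs_of_pos hρ.1]
  exact hρ.2

lemma ContinuousOn.circleIntegrable_of_mem_Ioo {E : Type*} [NormedAddCommGroup E] {g : ℂ → E}
    (hg : ContinuousOn g (Metric.ball 0 1)) (hρ : ρ ∈ Ioo (0 : ℝ) 1) :
    CircleIntegrable g 0 ρ :=
  (hg.mono fun _ hw => mem_ball_zero_iff.mpr (norm_lt_one_of_mem_sphere hρ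
    (by rwa [abs_of_pos hρ.1]))).circleIntegrable hρ.1.le

lemma differentiableOn_szegoKernel {a : ℂ} (ha : ‖a‖ < 1) :
    DifferentiableOn ℂ (fun w => (1 - conj a * w)⁻¹) (Metric.ball 0 1) := fun w hw => by
  have h0 := one_sub_conj_mul_ne_zero ha (mem_ball_zero_iff.mp hw)
  exact DifferentiableAt.differentiableWithinAt (by fun_prop (disch := exact h0))

/-- On |w| = ρ, w conj w = ρ² turns w conj(1 - conj a w) into w - ρ²a, so this is Cauchy's formula
at ρ²a. -/
lemma circleAverage_mul_conj_szegoKernel (hf : DifferentiableOn ℂ f (Metric.ball 0 1)) {a : ℂ}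
    (ha : ‖a‖ < 1) (hρ : ρ ∈ Ioo (0 : ℝ) 1) :
    Real.circleAverage (fun w => f w * conj ((1 - conj a * w)⁻¹)) 0 ρ = f (ρ ^ 2 * a) := by
  have hρ0 : (ρ : ℂ) ≠ 0 := Complex.ofReal_ne_zero.mpr hρ.1.ne'
  have hmem : (ρ ^ 2 * a : ℂ) ∈ Metric.ball (0 : ℂ) ρ := by
    rw [mem_ball_zero_iff, norm_mul, norm_pow, Complex.norm_real, Real.norm_of_nonneg hρ.1.le]
    nlinarith [hρ.1, hρ.2, norm_nonneg a]
  have hd : DiffContOnCl ℂ f (Metric.ball 0 ρ) :=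
    (hf.mono (Metric.closedBall_subset_ball hρ.2)).diffContOnCl_ball subset_rfl
  have hc := hd.two_pi_i_inv_smul_circleIntegral_sub_inv_smul hmem
  rw [Real.circleAverage_eq_circleIntegral hρ.1.ne', ← hc]
  congr 1
  refine circleIntegral.integral_congr hρ.1.le fun w hw => ?_
  have hw1 : ‖w‖ = ρ := mem_sphere_zero_iff_norm.mp hw
  have hw0 : w ≠ 0 := norm_pos_iff.mp (hw1 ▸ hρ.1)
  have hsq : w * conj w = (ρ : ℂ) ^ 2 := by
    rw [Complex.mul_conj, Complex.normSq_eq_norm_sq, hw1]; push_cast; rfl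
  have hsub : w - ρ ^ 2 * a = w * conj (1 - conj a * w) := by
    rw [← hsq]; simp only [map_sub, map_one, map_mul, Complex.conj_conj]; ring
  simp only [smul_eq_mul, sub_zero]
  rw [hsub, mul_inv, map_inv₀]
  ring

lemma circleAverage_norm_sq_le_hardyNorm_sq (hf : MemHardy f) (hρ : ρ ∈ Ioo (0 : ℝ) 1) :
    Real.circleAverage (fun w => ‖f w‖ ^ 2) 0 ρ ≤ hardyNorm f ^ 2 := by
  have h0 : 0 ≤ Real.circleAverage (fun w => ‖f w‖ ^ 2) 0 ρ :=
    Real.circleAverage_nonneg_of_nonneg fun _ _ => sq_nonneg _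
  have h1 : Real.circleAverage (fun w => ‖f w‖ ^ 2) 0 ρ ≤ sSup (squareMeans f) :=
    le_csSup hf.2 ⟨ρ, ⟨hρ.1.le, hρ.2⟩, rfl⟩
  rwa [hardyNorm, Real.sq_sqrt (h0.trans h1)]

lemma memHardy_of_bounded (hf : DifferentiableOn ℂ f (Metric.ball 0 1)) {M : ℝ}
    (hM : ∀ z ∈ Metric.ball (0 : ℂ) 1, ‖f z‖ ≤ M) : MemHardy f := by
  refine ⟨hf, M ^ 2, ?_⟩
  rintro _ ⟨ρ, hρ, rfl⟩
  have hball : ∀ w ∈ Metric.sphere (0 : ℂ) |ρ|, w ∈ Metric.ball (0 : ℂ) 1 := fun w hw => by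
    rw [mem_ball_zero_iff, mem_sphere_zero_iff_norm.mp hw, abs_of_nonneg hρ.1]
    exact hρ.2
  refine Real.circleAverage_mono_on_of_le_circle ?_ fun w hw =>
    pow_le_pow_left₀ (norm_nonneg _) (hM w (hball w hw)) 2
  exact ContinuousOn.circleIntegrable' ((hf.continuousOn.mono hball).norm.pow 2)

lemma memHardy_const_mul_szegoKernel {a : ℂ} (ha : ‖a‖ < 1) (b : ℂ) :
    MemHardy fun w => b * (1 - conj a * w)⁻¹ := by
  refine memHardy_of_bounded ((differentiableOn_szegoKernel ha).const_mul b)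
    (M := ‖b‖ * (1 - ‖a‖)⁻¹) fun z hz => ?_
  have hz' := mem_ball_zero_iff.mp hz
  have h : 1 - ‖a‖ ≤ ‖1 - conj a * z‖ := by
    have := one_sub_norm_le_norm_one_sub (a := z) (z := a) hz'.le
    rwa [← RCLike.norm_conj (1 - conj z * a), map_sub, map_mul, Complex.conj_conj, map_one,
      mul_comm] at this
  rw [norm_mul, norm_inv]
  have : 0 < 1 - ‖a‖ := by linarith
  gcongr

/-- Cauchy–Schwarz in the form 2xy ≤ t x² + t⁻¹ y²: each mean can be bounded separately before the
limit ρ → 1, and t is chosen only afterwards. -/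
lemma two_mul_norm_circleAverage_mul_conj_le {g : ℂ → ℂ}
    (hf : ContinuousOn f (Metric.ball 0 1)) (hg : ContinuousOn g (Metric.ball 0 1))
    (hρ : ρ ∈ Ioo (0 : ℝ) 1) {t : ℝ} (ht : 0 < t) :
    2 * ‖Real.circleAverage (fun w => f w * conj (g w)) 0 ρ‖
      ≤ t * Real.circleAverage (fun w => ‖f w‖ ^ 2) 0 ρ
        + t⁻¹ * Real.circleAverage (fun w => ‖g w‖ ^ 2) 0 ρ := by
  have hf2 := (hf.norm.pow 2).circleIntegrable_of_mem_Ioo hρ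
  have hg2 := (hg.norm.pow 2).circleIntegrable_of_mem_Ioo hρ
  have hfg := (hf.norm.mul hg.norm).circleIntegrable_of_mem_Ioo hρ
  have h1 : ‖Real.circleAverage (fun w => f w * conj (g w)) 0 ρ‖
      ≤ Real.circleAverage (fun w => ‖f w‖ * ‖g w‖) 0 ρ := by
    simp only [Real.circleAverage_def, norm_smul, smul_eq_mul]
    rw [Real.norm_of_nonneg (by positivity)]
    gcongr
    refine (intervalIntegral.norm_integral_le_integral_norm (by positivity)).trans_eq ?_
    simp only [norm_mul, RCLike.norm_conj]
  have h2 := Real.circleAverage_mono (hfg.const_fun_smul (a := (2 : ℝ)))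
    ((hf2.const_fun_smul (a := t)).add (hg2.const_fun_smul (a := t⁻¹))) fun w _ => by
      have : 0 ≤ t⁻¹ * (t * ‖f w‖ - ‖g w‖) ^ 2 := by positivity
      have e : t⁻¹ * (t * ‖f w‖ - ‖g w‖) ^ 2
          = t * ‖f w‖ ^ 2 + t⁻¹ * ‖g w‖ ^ 2 - 2 * (‖f w‖ * ‖g w‖) := by
        field_simp; ring
      simp only [Pi.add_apply, Pi.mul_apply, Pi.pow_apply, smul_eq_mul]
      linarith
  rw [Real.circleAverage_add (hf2.const_fun_smul (a := t)) (hg2.const_fun_smul (a := t⁻¹)),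
    Real.circleAverage_fun_smul, Real.circleAverage_fun_smul, Real.circleAverage_fun_smul] at h2
  simp only [smul_eq_mul] at h2
  exact (mul_le_mul_of_nonneg_left h1 zero_le_two).trans h2

end Hardy

section ModelSpace

variable {I : ℂ → ℂ} {a : ℂ}

/-- The square mean of the model space kernel numerator
`(1 - conj (I a) * I w) / (1 - conj a * w)`. -/
lemma circleAverage_norm_modelKernel_sq_le (hI : DifferentiableOn ℂ I (Metric.ball 0 1))
    (hI1 : ∀ z ∈ Metric.ball (0 : ℂ) 1, ‖I z‖ ≤ 1) (ha : ‖a‖ < 1) {ρ : ℝ}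
    (hρ : ρ ∈ Ioo (0 : ℝ) 1) :
    Real.circleAverage (fun w => ‖(1 - conj (I a) * I w) * (1 - conj a * w)⁻¹‖ ^ 2) 0 ρ
      ≤ ((1 + ‖I a‖ ^ 2 - 2 * conj (I a) * I (ρ ^ 2 * a))
          * (1 - conj a * (ρ ^ 2 * a))⁻¹).re := by
  have hk := differentiableOn_szegoKernel ha
  have hd : DifferentiableOn ℂ
      (fun w => (1 + ‖I a‖ ^ 2 - 2 * conj (I a) * I w) * (1 - conj a * w)⁻¹)
      (Metric.ball 0 1) := ((hI.const_mul _).const_sub _).mul hk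
  -- Replacing |I w|² by 1 in |1 - conj (I a) I w|² leaves the real part of a function holomorphic
  -- in w. The right side is thus itself a circle average, and a pointwise comparison suffices.
  rw [← circleAverage_mul_conj_szegoKernel hd ha hρ, ← Complex.reCLM_apply]
  have hkc : ContinuousOn (fun w => conj ((1 - conj a * w)⁻¹)) (Metric.ball 0 1) :=
    Complex.continuous_conj.comp_continuousOn hk.continuousOn
  have hint : CircleIntegrable (fun w => (1 + ‖I a‖ ^ 2 - 2 * conj (I a) * I w)
      * (1 - conj a * w)⁻¹ * conj ((1 - conj a * w)⁻¹)) 0 ρ :=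
    (hd.continuousOn.mul hkc).circleIntegrable_of_mem_Ioo hρ
  rw [← Complex.reCLM.circleAverage_comp_comm hint]
  refine Real.circleAverage_mono ?_ ?_ fun w hw => ?_
  · exact ((((hI.const_mul _).const_sub _).mul hk).continuousOn.norm.pow
      2).circleIntegrable_of_mem_Ioo hρ
  · exact (Complex.reCLM.continuous.comp_continuousOn
      (hd.continuousOn.mul hkc)).circleIntegrable_of_mem_Ioo hρ
  · have hw1 := hI1 w (mem_ball_zero_iff.mpr (norm_lt_one_of_mem_sphere hρ hw))
    have e : (((1 + ‖I a‖ ^ 2 - 2 * conj (I a) * I w) * (1 - conj a * w)⁻¹)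
        * conj ((1 - conj a * w)⁻¹)).re
        = (1 + ‖I a‖ ^ 2 - 2 * (conj (I a) * I w).re) * ‖(1 - conj a * w)⁻¹‖ ^ 2 := by
      rw [mul_assoc, Complex.mul_conj, Complex.normSq_eq_norm_sq, Complex.re_mul_ofReal]
      congr 1
      rw [mul_assoc, Complex.sub_re, Complex.add_re, Complex.one_re, ← Complex.ofReal_pow,
        Complex.ofReal_re, ← Complex.ofReal_ofNat, Complex.re_ofReal_mul]
    have e2 : ‖1 - conj (I a) * I w‖ ^ 2
        = 1 + ‖I a‖ ^ 2 * ‖I w‖ ^ 2 - 2 * (conj (I a) * I w).re := by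
      simp only [Complex.sq_norm, Complex.normSq_apply, Complex.sub_re, Complex.sub_im,
        Complex.mul_re, Complex.mul_im, Complex.conj_re, Complex.conj_im, Complex.one_re,
        Complex.one_im]
      ring
    simp only [Function.comp_apply, Complex.reCLM_apply]
    rw [e, norm_mul, mul_pow, e2]
    gcongr
    have := pow_le_one₀ (n := 2) (norm_nonneg (I w)) hw1
    exact mul_le_of_le_one_right (sq_nonneg _) this

/-- Point evaluations on a model space are bounded by the norm of the reproducing kernel. -/
lemma MemModelSpace.norm_le {f : ℂ → ℂ} (hf : MemModelSpace I f)
    (hI : DifferentiableOn ℂ I (Metric.ball 0 1))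
    (hI1 : ∀ z ∈ Metric.ball (0 : ℂ) 1, ‖I z‖ ≤ 1) (ha : ‖a‖ < 1) :
    ‖f a‖ ≤ hardyNorm f * √((1 - ‖I a‖ ^ 2) / (1 - ‖a‖ ^ 2)) := by
  have hball : Metric.ball (0 : ℂ) 1 ∈ 𝓝 a :=
    Metric.isOpen_ball.mem_nhds (mem_ball_zero_iff.mpr ha)
  have hIoo : ∀ᶠ ρ : ℝ in 𝓝[<] 1, ρ ∈ Ioo (0 : ℝ) 1 := Ioo_mem_nhdsLT one_pos
  have hscale : Tendsto (fun ρ : ℝ => (ρ ^ 2 * a : ℂ)) (𝓝[<] 1) (𝓝 a) := by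
    have : Continuous fun ρ : ℝ => (ρ ^ 2 * a : ℂ) := by fun_prop
    simpa using (this.tendsto 1).mono_left nhdsWithin_le_nhds
  have hfd := hf.1.1
  have hk := differentiableOn_szegoKernel ha
  -- Subtracting this vanishing pairing from Cauchy's formula turns the Szegő kernel into the model
  -- space kernel `K`.
  have horth := hf.2 _ (memHardy_const_mul_szegoKernel ha (conj (I a)))
  unfold HasHardyInner at horth
  set K : ℂ → ℂ := fun w => (1 - conj (I a) * I w) * (1 - conj a * w)⁻¹ with hK
  have hKd : DifferentiableOn ℂ K (Metric.ball 0 1) := ((hI.const_mul _).const_sub _).mul hk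
  have conj_cont {g : ℂ → ℂ} (hg : DifferentiableOn ℂ g (Metric.ball 0 1)) :
      ContinuousOn (fun w => conj (g w)) (Metric.ball 0 1) :=
    Complex.continuous_conj.comp_continuousOn hg.continuousOn
  have hrepr : Tendsto (fun ρ : ℝ => Real.circleAverage (fun w => f w * conj (K w)) 0 ρ)
      (𝓝[<] 1) (𝓝 (f a)) := by
    have h := ((hfd.differentiableAt hball).continuousAt.tendsto.comp hscale).sub horth
    rw [sub_zero] at h
    refine h.congr' ?_
    filter_upwards [hIoo] with ρ hρ
    have hi1 : CircleIntegrable (fun w => f w * conj ((1 - conj a * w)⁻¹)) 0 ρ :=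
      (hfd.continuousOn.mul (conj_cont hk)).circleIntegrable_of_mem_Ioo hρ
    have hi2 : CircleIntegrable
        (fun w => f w * conj (I w * (conj (I a) * (1 - conj a * w)⁻¹))) 0 ρ :=
      (hfd.continuousOn.mul (conj_cont (hI.mul (hk.const_mul _)))).circleIntegrable_of_mem_Ioo hρ
    rw [Function.comp_apply, ← circleAverage_mul_conj_szegoKernel hfd ha hρ,
      ← Real.circleAverage_fun_sub hi1 hi2]
    congr 1
    ext w
    rw [← mul_sub, ← map_sub, hK]
    congr 2
    ring
  have hlim : Tendsto (fun ρ : ℝ => ((1 + ‖I a‖ ^ 2 - 2 * conj (I a) * I (ρ ^ 2 * a))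
      * (1 - conj a * (ρ ^ 2 * a))⁻¹).re) (𝓝[<] 1)
      (𝓝 ((1 - ‖I a‖ ^ 2) / (1 - ‖a‖ ^ 2))) := by
    have hd : DifferentiableOn ℂ
        (fun w => (1 + ‖I a‖ ^ 2 - 2 * conj (I a) * I w) * (1 - conj a * w)⁻¹)
        (Metric.ball 0 1) := ((hI.const_mul _).const_sub _).mul hk
    have h := (Complex.continuous_re.tendsto _).comp
      ((hd.differentiableAt hball).continuousAt.tendsto.comp hscale)
    have hsq (b : ℂ) : conj b * b = ((‖b‖ ^ 2 : ℝ) : ℂ) := by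
      rw [mul_comm, Complex.mul_conj, Complex.normSq_eq_norm_sq]
    have e : (1 + (‖I a‖ : ℂ) ^ 2 - 2 * conj (I a) * I a) * (1 - conj a * a)⁻¹
        = (((1 - ‖I a‖ ^ 2) / (1 - ‖a‖ ^ 2) : ℝ) : ℂ) := by
      rw [mul_assoc, hsq, hsq]
      push_cast
      ring
    rw [e, Complex.ofReal_re] at h
    exact h
  set Q := (1 - ‖I a‖ ^ 2) / (1 - ‖a‖ ^ 2) with hQ
  have hQ0 : 0 ≤ Q := by
    have := hI1 a (mem_ball_zero_iff.mpr ha)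
    apply div_nonneg <;> nlinarith [norm_nonneg a, norm_nonneg (I a)]
  have hmain (t : ℝ) (ht : 0 < t) : 2 * ‖f a‖ ≤ t * hardyNorm f ^ 2 + t⁻¹ * Q := by
    refine le_of_tendsto_of_tendsto (hrepr.norm.const_mul 2)
      ((hlim.const_mul t⁻¹).const_add (t * hardyNorm f ^ 2)) ?_
    filter_upwards [hIoo] with ρ hρ
    refine (two_mul_norm_circleAverage_mul_conj_le hfd.continuousOn hKd.continuousOn hρ
      ht).trans ?_
    have h1 := circleAverage_norm_sq_le_hardyNorm_sq hf.1 hρ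
    have h2 := circleAverage_norm_modelKernel_sq_le hI hI1 ha hρ
    gcongr
  have hN : 0 ≤ hardyNorm f := Real.sqrt_nonneg _
  have hS : 0 ≤ √Q := Real.sqrt_nonneg _
  refine le_of_forall_pos_le_add fun ε hε => ?_
  obtain ⟨δ, hδ, hδε⟩ : ∃ δ > 0, δ * (hardyNorm f + √Q) ≤ ε :=
    ⟨ε / (hardyNorm f + √Q + 1), by positivity, by
      rw [div_mul_eq_mul_div, div_le_iff₀ (by positivity)]; nlinarith⟩
  -- The optimal t is √Q / ‖f‖; adding δ keeps it defined and positive when either quantity is zero.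
  have h := hmain ((√Q + δ) / (hardyNorm f + δ)) (by positivity)
  have h1 : (√Q + δ) / (hardyNorm f + δ) * hardyNorm f ^ 2 ≤ (√Q + δ) * hardyNorm f := by
    rw [div_mul_eq_mul_div, div_le_iff₀ (by positivity)]
    have : 0 ≤ (√Q + δ) * hardyNorm f * δ := by positivity
    linarith
  have h2 : ((√Q + δ) / (hardyNorm f + δ))⁻¹ * Q ≤ √Q * (hardyNorm f + δ) := by
    rw [inv_div, div_mul_eq_mul_div, div_le_iff₀ (by positivity)]
    have e : √Q * √Q = Q := Real.mul_self_sqrt hQ0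
    have : 0 ≤ √Q * (hardyNorm f + δ) * δ := by positivity
    nlinarith
  nlinarith

end ModelSpace

/-! ### Weighted estimates along a radius -/

/-- If d ≤ x, monotonicity of φ and x ≤ D suffice. If d ≥ x, the decrease of φ(x)/x² gives φ(d) x² ≤
φ(x) d², and d ≤ D + x ≤ 2D produces the factor 4. -/
lemma IsAdmissible.mul_sq_le {φ : ℝ → ℝ} (hφ : IsAdmissible φ) {x d D : ℝ} (hx : 0 < x)
    (hd : 0 < d) (hxD : x ≤ D) (hdD : d ≤ D + x) : φ d * x ^ 2 ≤ 4 * φ x * D ^ 2 := by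
  have hφx := hφ.pos x hx
  rcases le_total d x with h | h
  · have h1 : φ d ≤ φ x := hφ.mono hd hx h
    have h2 : x ^ 2 ≤ D ^ 2 := pow_le_pow_left₀ hx.le hxD 2
    calc φ d * x ^ 2 ≤ φ x * D ^ 2 := by gcongr
      _ ≤ 4 * φ x * D ^ 2 := by nlinarith [mul_nonneg hφx.le (sq_nonneg D)]
  · have h1 : φ d / d ^ 2 ≤ φ x / x ^ 2 := hφ.anti hx hd h
    rw [div_le_div_iff₀ (by positivity) (by positivity)] at h1
    have h2 : d ^ 2 ≤ (2 * D) ^ 2 := pow_le_pow_left₀ hd.le (by linarith) 2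
    calc φ d * x ^ 2 ≤ φ x * d ^ 2 := h1
      _ ≤ φ x * (2 * D) ^ 2 := by gcongr
      _ = 4 * φ x * D ^ 2 := by ring

lemma IsAdmissible.ofReal_one_div_sq_le {φ : ℝ → ℝ} (hφ : IsAdmissible φ) {x d D : ℝ}
    (hx : 0 < x) (hxD : x ≤ D) (hdD : d ≤ D + x) :
    ENNReal.ofReal (1 / D ^ 2) ≤ ENNReal.ofReal (4 * φ x / x ^ 2) * invWeight φ d := by
  have hφx := hφ.pos x hx
  unfold invWeight
  split_ifs with hd
  · have hφd := hφ.pos d hd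
    have hD : 0 < D := hx.trans_le hxD
    rw [← ENNReal.ofReal_inv_of_pos hφd, ← ENNReal.ofReal_mul (by positivity)]
    refine ENNReal.ofReal_le_ofReal ?_
    rw [← div_eq_mul_inv, div_div, div_le_div_iff₀ (by positivity) (by positivity), one_mul,
      mul_comm (x ^ 2)]
    exact hφ.mul_sq_le hx hd hxD hdD
  · rw [ENNReal.mul_top (by rw [Ne, ENNReal.ofReal_eq_zero, not_le]; positivity)]
    exact le_top

/-- Since |ζ| = 1, |ζ - a| = |1 - conj a ζ|, and moving ζ to rζ costs at most 1 - r. -/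
lemma norm_sub_le_norm_one_sub_add {a : ℂ} (ha : ‖a‖ < 1) (ζ : UnitCircle) {r : ℝ}
    (hr : r < 1) : ‖(ζ : ℂ) - a‖ ≤ ‖1 - conj a * (r * ζ)‖ + (1 - r) := by
  have hζ : ‖(ζ : ℂ)‖ = 1 := mem_sphere_zero_iff_norm.mp ζ.2
  have hζ2 : conj (ζ : ℂ) * ζ = 1 := by
    rw [mul_comm, Complex.mul_conj, Complex.normSq_eq_norm_sq, hζ]; simp
  have h1 : ‖(ζ : ℂ) - a‖ = ‖1 - conj a * ζ‖ := by
    rw [← hζ2, ← sub_mul, ← map_sub, norm_mul, RCLike.norm_conj, hζ, mul_one]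
  have h2 : 1 - conj a * ζ = (1 - conj a * (r * ζ)) + -((1 - r : ℝ) * (conj a * ζ)) := by
    push_cast; ring
  rw [h1, h2]
  refine (norm_add_le _ _).trans (add_le_add_right ?_ _)
  rw [norm_neg, norm_mul, norm_mul, RCLike.norm_conj, hζ, Complex.norm_real,
    Real.norm_of_nonneg (by linarith)]
  nlinarith

lemma norm_sub_le_norm_sub_radius_add (ξ ζ : UnitCircle) {r : ℝ} (hr : r < 1) :
    ‖(ζ : ℂ) - ξ‖ ≤ ‖(ξ : ℂ) - r * ζ‖ + (1 - r) := by
  have hζ : ‖(ζ : ℂ)‖ = 1 := mem_sphere_zero_iff_norm.mp ζ.2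
  have h : (ξ : ℂ) - ζ = ((ξ : ℂ) - r * ζ) + -((1 - r : ℝ) * (ζ : ℂ)) := by push_cast; ring
  rw [norm_sub_rev, h]
  refine (norm_add_le _ _).trans (add_le_add_right ?_ _)
  rw [norm_neg, norm_mul, hζ, Complex.norm_real, Real.norm_of_nonneg (by linarith), mul_one]

lemma norm_ofReal_mul_circle (ζ : UnitCircle) {r : ℝ} (hr : 0 ≤ r) : ‖(r * ζ : ℂ)‖ = r := by
  rw [norm_mul, mem_sphere_zero_iff_norm.mp ζ.2, mul_one, Complex.norm_real,
    Real.norm_of_nonneg hr]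

lemma one_sub_norm_blaschkeProduct_sq_radius_le {ι : Type*} {Λ : ι → ℂ} (hΛ : ∀ i, ‖Λ i‖ < 1)
    (hsum : Summable fun i => 1 - ‖Λ i‖) {φ : ℝ → ℝ} (hφ : IsAdmissible φ) (ζ : UnitCircle)
    (hfin : ∑' i, ENNReal.ofReal (1 - ‖Λ i‖) * invWeight φ ‖(ζ : ℂ) - Λ i‖ ≠ ∞) {r : ℝ}
    (hr0 : 0 ≤ r) (hr1 : r < 1) :
    1 - ‖blaschkeProduct Λ (r * ζ)‖ ^ 2 ≤ 8 * (1 - r ^ 2) * (φ (1 - r) / (1 - r) ^ 2) *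
      (∑' i, ENNReal.ofReal (1 - ‖Λ i‖) * invWeight φ ‖(ζ : ℂ) - Λ i‖).toReal := by
  set T := ∑' i, ENNReal.ofReal (1 - ‖Λ i‖) * invWeight φ ‖(ζ : ℂ) - Λ i‖
  have hz := norm_ofReal_mul_circle ζ hr0
  have hz1 : ‖(r * ζ : ℂ)‖ < 1 := hz.trans_lt hr1
  have hx : 0 < 1 - r := by linarith
  have hr2 : 0 < 1 - r ^ 2 := by nlinarith
  have hφx := hφ.pos _ hx
  have hterm (i : ι) : ENNReal.ofReal (1 - ‖blaschkeFactor (Λ i) (r * ζ)‖ ^ 2)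
      ≤ ENNReal.ofReal (8 * (1 - r ^ 2) * (φ (1 - r) / (1 - r) ^ 2)) *
        (ENNReal.ofReal (1 - ‖Λ i‖) * invWeight φ ‖(ζ : ℂ) - Λ i‖) := by
    have ha : 0 ≤ 1 - ‖Λ i‖ := by linarith [hΛ i]
    have hk := hφ.ofReal_one_div_sq_le hx
      (by simpa only [hz] using one_sub_norm_le_norm_one_sub (z := (r * ζ : ℂ)) (hΛ i).le)
      (norm_sub_le_norm_one_sub_add (hΛ i) ζ hr1)
    -- The final 8 is 2 · 4: 1 - |λ|² ≤ 2(1 - |λ|), and 4 comes from the weight comparison.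
    calc ENNReal.ofReal (1 - ‖blaschkeFactor (Λ i) (r * ζ)‖ ^ 2)
        ≤ ENNReal.ofReal (2 * (1 - r ^ 2) * (1 - ‖Λ i‖)
            * (1 / ‖1 - conj (Λ i) * (r * ζ)‖ ^ 2)) := by
          refine ENNReal.ofReal_le_ofReal ?_
          rw [one_sub_norm_blaschkeFactor_sq (hΛ i) hz1, hz, div_eq_mul_one_div]
          refine mul_le_mul_of_nonneg_right ?_ (by positivity)
          nlinarith [hΛ i, norm_nonneg (Λ i), mul_nonneg ha hr2.le]
      _ = ENNReal.ofReal (2 * (1 - r ^ 2)) * ENNReal.ofReal (1 - ‖Λ i‖)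
            * ENNReal.ofReal (1 / ‖1 - conj (Λ i) * (r * ζ)‖ ^ 2) := by
          rw [ENNReal.ofReal_mul (by positivity), ENNReal.ofReal_mul (by positivity)]
      _ ≤ ENNReal.ofReal (2 * (1 - r ^ 2)) * ENNReal.ofReal (1 - ‖Λ i‖)
            * (ENNReal.ofReal (4 * φ (1 - r) / (1 - r) ^ 2)
              * invWeight φ ‖(ζ : ℂ) - Λ i‖) := by gcongr
      _ = _ := by
          rw [show 8 * (1 - r ^ 2) * (φ (1 - r) / (1 - r) ^ 2)
            = 2 * (1 - r ^ 2) * (4 * φ (1 - r) / (1 - r) ^ 2) by ring,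
            ENNReal.ofReal_mul (p := 2 * (1 - r ^ 2)) (by positivity)]
          ac_rfl
  refine one_sub_norm_blaschkeProduct_sq_le hΛ hsum hz1 fun s => ?_
  have hnn (i : ι) : 0 ≤ 1 - ‖blaschkeFactor (Λ i) (r * ζ)‖ ^ 2 := by
    have := pow_le_one₀ (n := 2) (norm_nonneg _) (norm_blaschkeFactor_le_one (hΛ i) hz1)
    linarith
  rw [← ENNReal.ofReal_le_ofReal_iff (by positivity),
    ENNReal.ofReal_sum_of_nonneg fun i _ => hnn i, ENNReal.ofReal_mul (by positivity),
    ENNReal.ofReal_toReal hfin]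
  calc ∑ i ∈ s, ENNReal.ofReal (1 - ‖blaschkeFactor (Λ i) (r * ζ)‖ ^ 2)
      ≤ ∑ i ∈ s, _ := Finset.sum_le_sum fun i _ => hterm i
    _ ≤ ∑' i, _ := ENNReal.sum_le_tsum s
    _ = _ := ENNReal.tsum_mul_left

lemma one_sub_norm_singularInner_sq_radius_le (μ : Measure UnitCircle) [IsFiniteMeasure μ]
    {φ : ℝ → ℝ} (hφ : IsAdmissible φ) (ζ : UnitCircle)
    (hfin : ∫⁻ ξ : UnitCircle, invWeight φ ‖(ζ : ℂ) - (ξ : ℂ)‖ ∂μ ≠ ∞) {r : ℝ}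
    (hr0 : 0 ≤ r) (hr1 : r < 1) :
    1 - ‖singularInner μ (r * ζ)‖ ^ 2 ≤ 8 * (1 - r ^ 2) * (φ (1 - r) / (1 - r) ^ 2) *
      (∫⁻ ξ : UnitCircle, invWeight φ ‖(ζ : ℂ) - (ξ : ℂ)‖ ∂μ).toReal := by
  set T := ∫⁻ ξ : UnitCircle, invWeight φ ‖(ζ : ℂ) - (ξ : ℂ)‖ ∂μ
  have hz := norm_ofReal_mul_circle ζ hr0
  have hz1 : ‖(r * ζ : ℂ)‖ < 1 := hz.trans_lt hr1
  have hx : 0 < 1 - r := by linarith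
  have hr2 : 0 < 1 - r ^ 2 := by nlinarith
  have hφx := hφ.pos _ hx
  have hint : ∫ ξ : UnitCircle, 1 / ‖(ξ : ℂ) - r * ζ‖ ^ 2 ∂μ
      ≤ 4 * φ (1 - r) / (1 - r) ^ 2 * T.toReal := by
    have hcont : Continuous fun ξ : UnitCircle => 1 / ‖(ξ : ℂ) - r * ζ‖ ^ 2 :=
      continuous_const.div (by fun_prop)
        fun ξ => pow_ne_zero 2 (norm_ne_zero_iff.mpr (circle_sub_ne_zero ξ hz1))
    rw [integral_eq_lintegral_of_nonneg_ae (Eventually.of_forall fun _ => by positivity)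
      hcont.aestronglyMeasurable]
    refine ENNReal.toReal_le_of_le_ofReal (by positivity) ?_
    rw [ENNReal.ofReal_mul (by positivity), ENNReal.ofReal_toReal hfin,
      ← lintegral_const_mul' _ _ ENNReal.ofReal_ne_top]
    exact lintegral_mono fun ξ => hφ.ofReal_one_div_sq_le hx
      (by simpa only [hz] using one_sub_norm_le_norm_sub ξ (r * ζ : ℂ))
      (norm_sub_le_norm_sub_radius_add ξ ζ hr1)
  -- Here 8 = 2 · 4 with the 2 coming from squaring the exponential.
  calc 1 - ‖singularInner μ (r * ζ)‖ ^ 2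
      ≤ 2 * ((1 - r ^ 2) * ∫ ξ : UnitCircle, 1 / ‖(ξ : ℂ) - r * ζ‖ ^ 2 ∂μ) := by
        simpa only [hz] using one_sub_norm_singularInner_sq_le μ hz1
    _ ≤ 2 * ((1 - r ^ 2) * (4 * φ (1 - r) / (1 - r) ^ 2 * T.toReal)) := by gcongr
    _ = _ := by ring

theorem theorem1p3 {ι : Type*} [Countable ι]
    (Λ : ι → ℂ) (hΛ : ∀ i, ‖Λ i‖ < 1) (hΛsum : Summable fun i => 1 - ‖Λ i‖)
    (μ : Measure UnitCircle) [IsFiniteMeasure μ] (hμ : μ ⟂ₘ arcLength)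
    (c : ℂ) (hc : ‖c‖ = 1)
    (I : ℂ → ℂ)
    (hI : ∀ z ∈ Metric.ball (0 : ℂ) 1, I z = c * blaschkeProduct Λ z * singularInner μ z)
    (φ : ℝ → ℝ) (hφ : IsAdmissible φ) (ζ : UnitCircle)
    (hsum : (∑' i, ENNReal.ofReal (1 - ‖Λ i‖) * invWeight φ ‖(ζ : ℂ) - Λ i‖)
      + ∫⁻ ξ : UnitCircle, invWeight φ ‖(ζ : ℂ) - (ξ : ℂ)‖ ∂μ < ∞) :
    ∃ C : ℝ, 0 < C ∧ ∀ f : ℂ → ℂ, MemModelSpace I f → ∀ r : ℝ, 0 ≤ r → r < 1 →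
      ‖f (r * (ζ : ℂ))‖ ≤ C * hardyNorm f * (√(φ (1 - r)) / (1 - r)) := by
  obtain ⟨hB, hS⟩ := ENNReal.add_lt_top.mp hsum
  set TB := (∑' i, ENNReal.ofReal (1 - ‖Λ i‖) * invWeight φ ‖(ζ : ℂ) - Λ i‖).toReal with hTB
  set TS := (∫⁻ ξ : UnitCircle, invWeight φ ‖(ζ : ℂ) - (ξ : ℂ)‖ ∂μ).toReal with hTS
  have hTB0 : 0 ≤ TB := ENNReal.toReal_nonneg
  have hTS0 : 0 ≤ TS := ENNReal.toReal_nonneg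
  have hId : DifferentiableOn ℂ I (Metric.ball 0 1) :=
    (((differentiableOn_blaschkeProduct hΛ hΛsum).const_mul c).mul
      (differentiableOn_singularInner μ)).congr hI
  have hInorm (z : ℂ) (hz : z ∈ Metric.ball (0 : ℂ) 1) :
      ‖I z‖ = ‖blaschkeProduct Λ z‖ * ‖singularInner μ z‖ := by
    rw [hI z hz, norm_mul, norm_mul, hc, one_mul]
  have hI1 (z : ℂ) (hz : z ∈ Metric.ball (0 : ℂ) 1) : ‖I z‖ ≤ 1 := by
    have hz' := mem_ball_zero_iff.mp hz
    rw [hInorm z hz]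
    exact mul_le_one₀ (norm_blaschkeProduct_le_one hΛ hΛsum hz') (norm_nonneg _)
      (norm_singularInner_le_one μ hz')
  -- The summand 1 keeps the constant positive when I is a unimodular constant.
  refine ⟨√(8 * (TB + TS) + 1), by positivity, fun f hf r hr0 hr1 => ?_⟩
  have hz := norm_ofReal_mul_circle ζ hr0
  have hz1 : ‖(r * ζ : ℂ)‖ < 1 := hz.trans_lt hr1
  have hx : 0 < 1 - r := by linarith
  have hr2 : 0 < 1 - r ^ 2 := by nlinarith
  have hφx := hφ.pos _ hx
  have hbound := hf.norm_le hId hI1 hz1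
  have hkernel : (1 - ‖I (r * ζ)‖ ^ 2) / (1 - ‖(r * ζ : ℂ)‖ ^ 2)
      ≤ (8 * (TB + TS) + 1) * (φ (1 - r) / (1 - r) ^ 2) := by
    have h1 := one_sub_norm_blaschkeProduct_sq_radius_le hΛ hΛsum hφ ζ hB.ne hr0 hr1
    have h2 := one_sub_norm_singularInner_sq_radius_le μ hφ ζ hS.ne hr0 hr1
    rw [← hTB] at h1
    rw [← hTS] at h2
    have hb := pow_le_one₀ (n := 2) (norm_nonneg _) (norm_blaschkeProduct_le_one hΛ hΛsum hz1)
    have hs := pow_le_one₀ (n := 2) (norm_nonneg _) (norm_singularInner_le_one μ hz1)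
    have hpos : 0 ≤ (1 - r ^ 2) * (φ (1 - r) / (1 - r) ^ 2) := by positivity
    rw [hz, div_le_iff₀ hr2, hInorm _ (mem_ball_zero_iff.mpr hz1), mul_pow]
    -- With b = |B|² and s = |S_μ|², (1 - b)(1 - s) ≥ 0 says 1 - bs ≤ (1 - b) + (1 - s).
    nlinarith [mul_nonneg (sub_nonneg.mpr hb) (sub_nonneg.mpr hs)]
  calc ‖f (r * ζ)‖ ≤ hardyNorm f * √((8 * (TB + TS) + 1) * (φ (1 - r) / (1 - r) ^ 2)) :=
        hbound.trans (mul_le_mul_of_nonneg_left (Real.sqrt_le_sqrt hkernel) (Real.sqrt_nonneg _))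
    _ = √(8 * (TB + TS) + 1) * hardyNorm f * (√(φ (1 - r)) / (1 - r)) := by
        rw [Real.sqrt_mul (by positivity), Real.sqrt_div hφx.le, Real.sqrt_sq hx.le]
        ring
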